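/- Let $L\ge 1$, $d'\ge 3$, $d=Ld'$ and $m\ge 1$ be integers. For a finite nonempty family $S$ of unit vectors in $\mathbb R^d$ and $v\in\mathbb S^{d-1}$, let $Z_S(v)\in\operatorname{argmax}_{u\in S}\langle u,v\rangle$ and $A_S(v)=\langle v,Z_S(v)\rangle$ (the cosine of the reference angle). Let $J(S)=\mathbb E[A_S(v)]$, where $v$ is uniformly distributed on $\mathbb S^{d-1}$. If $S$ is random, then $v$ is independent of $S$ and $J(S)$ denotes the expectation over both $S$ and $v$. Let $S_{\mathrm{ran}}(m,L)$ be the following random configuration: for each level $l=1,\dots,L$ draw $m$ points of $\mathbb S^{d'-1}$ uniformly, all draws (also across levels) being independent; scale all points to norm $1/\sqrt L$; the configuration consists of the $m^L$ unit vectors of $\mathbb R^d=(\mathbb R^{d'})^L$ obtained by concatenating one scaled point from each level. For even $m$, let $S_{\mathrm{sym}}(m,L)$ be obtained in the same way, except that the $m$ points of each level are $m/2$ independent uniform points of $\mathbb S^{d'-1}$ together with their antipodal points. Put $$c_{d'}=\frac{\Gamma(\frac{d'}{2})}{\sqrt{\pi}\,\Gamma(\frac{d'-1}{2})},\qquad f(y)=c_{d'}(1-y^2)^{\frac{d'-3}{2}},\qquad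 F(y)=\int_{-1}^y f(t)\,dt \qquad (y\in[-1,1]),$$ $$B(m,L)=m\sqrt{L}\;\frac{\Gamma(\frac{d+L}{2L})\,\Gamma(\frac d2)}{\Gamma(\frac{d}{2L})\,\Gamma(\frac{d+1}{2})}\int_{-1}^1 y\,F(y)^{m-1}f(y)\,dy .$$ Then: 1. if $m$ is even, $J(S_{\mathrm{sym}}(m,L))>B(m,L)$; 2. $J(S_{\mathrm{ran}}(m,L))=B(m,L)$; 3. for every fixed $x\in\mathbb S^{d'-1}$ and $u$ uniform on $\mathbb S^{d'-1}$, the random variable $\langle x,u\rangle$ has density $f$ on $[-1,1]$ (with respect to Lebesgue measure), and $\mathbb P(\langle x,u\rangle\le y)=F(y)$ for $y\in[-1,1]$. -/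

import Mathlib

namespace RefAngle

open MeasureTheory

noncomputable section

/-- The unit sphere of `ℝ^ι` with its Euclidean norm. -/
abbrev USphere (ι : Type*) [Fintype ι] : Type _ :=
  Metric.sphere (0 : EuclideanSpace ℝ ι) 1

/-- The uniform distribution on the unit sphere of `ℝ^ι`: the surface measure induced by Lebesgue
measure, normalized to total mass one. -/
def sphereUniform (ι : Type*) [Fintype ι] : Measure (USphere ι) :=
  ((volume : Measure (EuclideanSpace ℝ ι)).toSphere Set.univ)⁻¹ •
    (volume : Measure (EuclideanSpace ℝ ι)).toSphere

section Reference

variable {E : Type*} [NormedAddCommGroup E] [InnerProductSpace ℝ E] {κ : Type*}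

open Classical in
/-- The reference vector `Z_S(v)`: a member of the family `S` whose inner product with `v` is
maximal. (A maximizer exists for every finite nonempty family; the value `0` is used otherwise.) -/
def refVector (S : κ → E) (v : E) : E :=
  if h : ∃ i, ∀ j, inner ℝ (S j) v ≤ inner ℝ (S i) v then S h.choose else 0

/-- The cosine `A_S(v) = ⟨v, Z_S(v)⟩` of the reference angle of the unit vector `v`. -/
def refCos (S : κ → E) (v : E) : ℝ :=
  inner ℝ v (refVector S v)

end Reference

/-- `J(S) = 𝔼_v [A_S(v)]` with `v` uniformly distributed on the unit sphere. -/
def J {ι κ : Type*} [Fintype ι] (S : κ → EuclideanSpace ℝ ι) : ℝ :=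
  ∫ v : USphere ι, refCos S (v : EuclideanSpace ℝ ι) ∂(sphereUniform ι)

/-- The multi-level configuration obtained from one family `w l` of points on the unit sphere of
`ℝ^d'` per level `l`: all points are scaled to norm `1/√L`, and one point per level is selected
(in all possible ways `k`) and the selected points are concatenated. The ambient space `ℝ^(L d')`
has its coordinates indexed by pairs (level, coordinate within the level). -/
def multiLevel {L d' : ℕ} {κ : Type*} (w : Fin L → κ → USphere (Fin d')) :
    (Fin L → κ) → EuclideanSpace ℝ (Fin L × Fin d') :=
  fun k => WithLp.toLp 2 fun p =>
    (1 / Real.sqrt L) * (w p.1 (k p.1) : EuclideanSpace ℝ (Fin d')) p.2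

/-- The family consisting of the points `w i` along with their antipodal points `-w i`. -/
def antipodal {d' : ℕ} {κ : Type*} (w : κ → USphere (Fin d')) : κ ⊕ κ → USphere (Fin d') :=
  Sum.elim w fun i => -w i

/-- `J(S_ran(m,L))`: in each of the `L` levels, `m` independent uniform points on the unit sphere
of `ℝ^d'`; the expectation is over the random configuration and the random vector `v`. -/
def JRan (d' m L : ℕ) : ℝ :=
  ∫ w : Fin L → Fin m → USphere (Fin d'), J (multiLevel w)
    ∂(Measure.pi fun _ => Measure.pi fun _ => sphereUniform (Fin d'))

/-- `J(S_sym(m,L))` for even `m`: in each of the `L` levels, `m/2` independent uniform points on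
the unit sphere of `ℝ^d'` along with their antipodal points; the expectation is over the random
configuration and the random vector `v`. -/
def JSym (d' m L : ℕ) : ℝ :=
  ∫ w : Fin L → Fin (m / 2) → USphere (Fin d'), J (multiLevel fun l => antipodal (w l))
    ∂(Measure.pi fun _ => Measure.pi fun _ => sphereUniform (Fin d'))

/-- `c_{d'} = Γ(d'/2) / (√π Γ((d'-1)/2))`. -/
def cosConst (d' : ℕ) : ℝ :=
  Real.Gamma ((d' : ℝ) / 2) / (Real.sqrt Real.pi * Real.Gamma (((d' : ℝ) - 1) / 2))

/-- `f(y) = c_{d'} (1 - y²)^((d'-3)/2)`. -/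
def cosDensity (d' : ℕ) (y : ℝ) : ℝ :=
  cosConst d' * (1 - y ^ 2) ^ (((d' : ℝ) - 3) / 2)

/-- `F(y) = ∫_{-1}^y f(t) dt`. -/
def cosCDF (d' : ℕ) (y : ℝ) : ℝ :=
  ∫ t in (-1 : ℝ)..y, cosDensity d' t

/-- The expression
`m √L · Γ((d+L)/(2L)) Γ(d/2) / (Γ(d/(2L)) Γ((d+1)/2)) · ∫_{-1}^1 y F(y)^(m-1) f(y) dy`. -/
def lowerBound (d d' m L : ℕ) : ℝ :=
  (m : ℝ) * Real.sqrt L *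
    ((Real.Gamma (((d : ℝ) + L) / (2 * L)) * Real.Gamma ((d : ℝ) / 2)) /
      (Real.Gamma ((d : ℝ) / (2 * L)) * Real.Gamma (((d : ℝ) + 1) / 2))) *
    ∫ y in (-1 : ℝ)..1, y * cosCDF d' y ^ (m - 1) * cosDensity d' y

end

end RefAngle

namespace RefAngle

open MeasureTheory Set

noncomputable section

section Polar

variable {E : Type*} [NormedAddCommGroup E] [InnerProductSpace ℝ E] [FiniteDimensional ℝ E]
  [MeasurableSpace E] [BorelSpace E]

/-- Integration in polar coordinates. -/
theorem lintegral_polar [Nontrivial E] {f : E → ENNReal} (hf : Measurable f) :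
    ∫⁻ x, f x = ∫⁻ u : Metric.sphere (0 : E) 1, (∫⁻ r in Ioi (0 : ℝ),
      ENNReal.ofReal (r ^ (Module.finrank ℝ E - 1)) * f (r • (u : E)))
        ∂(volume : Measure E).toSphere := by
  have hmeas : Measurable fun p : Metric.sphere (0 : E) 1 × Ioi (0 : ℝ) =>
      f ((p.2 : ℝ) • (p.1 : E)) := by fun_prop
  have h := (volume : Measure E).measurePreserving_homeomorphUnitSphereProd.lintegral_comp hmeas
  have h2 : ∀ x : ({(0 : E)}ᶜ : Set E),
      f (((homeomorphUnitSphereProd E x).2 : ℝ) • ((homeomorphUnitSphereProd E x).1 : E))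
        = f x := by
    intro x
    have hx : ‖(x : E)‖ ≠ 0 := norm_ne_zero_iff.2 x.2
    simp [smul_smul, hx]
  simp only [h2] at h
  rw [lintegral_subtype_comap (measurableSet_singleton _).compl, restrict_compl_singleton,
    lintegral_prod _ hmeas.aemeasurable] at h
  rw [h]
  refine lintegral_congr fun u => ?_
  rw [Measure.volumeIoiPow, lintegral_withDensity_eq_lintegral_mul _ (by fun_prop) (by fun_prop)]
  exact lintegral_subtype_comap measurableSet_Ioi
    (fun r : ℝ => ENNReal.ofReal (r ^ (Module.finrank ℝ E - 1)) * f (r • (u : E)))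

theorem lintegral_pow_mul_exp_neg_sq (k : ℕ) :
    ∫⁻ r in Ioi (0 : ℝ), ENNReal.ofReal (r ^ k) * ENNReal.ofReal (Real.exp (-r ^ 2)) =
      ENNReal.ofReal (Real.Gamma (((k : ℝ) + 1) / 2) / 2) := by
  have h := integral_rpow_mul_exp_neg_rpow (p := 2) (q := k) (by norm_num)
    (by have : (0 : ℝ) ≤ k := k.cast_nonneg
        linarith)
  simp only [Real.rpow_natCast, Real.rpow_ofNat] at h
  have hpos : 0 < Real.Gamma (((k : ℝ) + 1) / 2) := Real.Gamma_pos_of_pos (by positivity)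
  rw [show Real.Gamma (((k : ℝ) + 1) / 2) / 2 = 1 / 2 * Real.Gamma (((k : ℝ) + 1) / 2) by ring,
    ← h, ofReal_integral_eq_lintegral_ofReal]
  · refine setLIntegral_congr_fun measurableSet_Ioi fun r hr => ?_
    rw [ENNReal.ofReal_mul (pow_nonneg (le_of_lt hr) _)]
  · by_contra hc
    rw [integral_undef hc] at h
    linarith
  · filter_upwards [ae_restrict_mem measurableSet_Ioi] with r hr
    exact mul_nonneg (pow_nonneg (le_of_lt hr) _) (Real.exp_pos _).le

/-- The Gaussian integral of a function that is positively homogeneous of degree `k`. -/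
theorem lintegral_homogeneous_mul_gaussian [Nontrivial E] {φ : E → ENNReal} (hφ : Measurable φ)
    (k : ℕ) (hk : ∀ r : ℝ, 0 < r → ∀ x : E, φ (r • x) = ENNReal.ofReal (r ^ k) * φ x) :
    ∫⁻ x, φ x * ENNReal.ofReal (Real.exp (-‖x‖ ^ 2)) =
      (∫⁻ u : Metric.sphere (0 : E) 1, φ u ∂(volume : Measure E).toSphere) *
        ENNReal.ofReal (Real.Gamma (((Module.finrank ℝ E : ℝ) + k) / 2) / 2) := by
  have hn : 0 < Module.finrank ℝ E := Module.finrank_pos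
  rw [lintegral_polar (by fun_prop), ← lintegral_mul_const _ (by fun_prop)]
  refine lintegral_congr fun u => ?_
  have hu : ‖(u : E)‖ = 1 := by simp
  have h := lintegral_pow_mul_exp_neg_sq (Module.finrank ℝ E - 1 + k)
  rw [show (((Module.finrank ℝ E - 1 + k : ℕ) : ℝ) + 1) = (Module.finrank ℝ E : ℝ) + k by
    push_cast [Nat.cast_sub (show 1 ≤ Module.finrank ℝ E from hn)]; ring] at h
  rw [← h, ← lintegral_const_mul _ (by fun_prop)]
  refine setLIntegral_congr_fun measurableSet_Ioi fun r hr => ?_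
  have hr' : (0 : ℝ) < r := hr
  rw [hk r hr', norm_smul, hu, mul_one, Real.norm_eq_abs, sq_abs, pow_add,
    ENNReal.ofReal_mul (by positivity)]
  ring

/-- Integration over the decomposition of the space into a subspace and its orthogonal
complement. -/
theorem lintegral_orthogonal (K : Submodule ℝ E) {φ : K × Kᗮ → ENNReal} (hφ : Measurable φ) :
    ∫⁻ x, φ (K.orthogonalProjectionOnto x, Kᗮ.orthogonalProjectionOnto x) =
      ∫⁻ y : K, ∫⁻ z : Kᗮ, φ (y, z) := by
  have hT := (WithLp.volume_preserving_ofLp K Kᗮ).comp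
    K.orthogonalDecomposition.measurePreserving
  have h := hT.lintegral_comp hφ
  rw [Measure.volume_eq_prod, lintegral_prod _ hφ.aemeasurable] at h
  rw [← h]
  refine lintegral_congr fun x => ?_
  simp [Submodule.orthogonalDecomposition_apply]

/-- The Gaussian integral of a function of the projection onto a subspace. -/
theorem lintegral_gaussian_orthogonal (K : Submodule ℝ E) {φ : K → ENNReal} (hφ : Measurable φ) :
    ∫⁻ x, φ (K.orthogonalProjectionOnto x) * ENNReal.ofReal (Real.exp (-‖x‖ ^ 2)) =
      (∫⁻ y : K, φ y * ENNReal.ofReal (Real.exp (-‖y‖ ^ 2))) *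
        ∫⁻ z : Kᗮ, ENNReal.ofReal (Real.exp (-‖z‖ ^ 2)) := by
  have h := lintegral_orthogonal K (φ := fun p : K × Kᗮ =>
    φ p.1 * ENNReal.ofReal (Real.exp (-‖p.1‖ ^ 2)) * ENNReal.ofReal (Real.exp (-‖p.2‖ ^ 2)))
    (by fun_prop)
  rw [← lintegral_mul_const _ (by fun_prop)]
  simp only [lintegral_const_mul _
    (show Measurable fun z : Kᗮ => ENNReal.ofReal (Real.exp (-‖z‖ ^ 2)) by fun_prop)] at h
  rw [← h]
  refine lintegral_congr fun x => ?_
  rw [mul_assoc, ← ENNReal.ofReal_mul (Real.exp_pos _).le, ← Real.exp_add,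
    K.norm_sq_eq_add_norm_sq_projection x, neg_add]

end Polar

section Sphere

variable {E : Type*} [NormedAddCommGroup E] [InnerProductSpace ℝ E] [FiniteDimensional ℝ E]
  [MeasurableSpace E] [BorelSpace E]

theorem eq_ofReal_div_of_mul_ofReal_eq {I : ENNReal} {a b : ℝ} (ha : 0 < a)
    (h : I * ENNReal.ofReal a = ENNReal.ofReal b) : I = ENNReal.ofReal (b / a) := by
  rw [ENNReal.ofReal_div_of_pos ha, ← h, ENNReal.mul_div_cancel_right (by simpa using ha)
    ENNReal.ofReal_ne_top]

variable (E) in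
theorem lintegral_gaussian :
    ∫⁻ x : E, ENNReal.ofReal (Real.exp (-‖x‖ ^ 2)) =
      ENNReal.ofReal (Real.pi ^ ((Module.finrank ℝ E : ℝ) / 2)) := by
  have h := GaussianFourier.integral_rexp_neg_mul_sq_norm (V := E) (b := 1) one_pos
  simp only [neg_mul, one_mul, div_one] at h
  rw [← h, ofReal_integral_eq_lintegral_ofReal]
  · by_contra hc
    rw [integral_undef hc] at h
    exact (Real.rpow_pos_of_pos Real.pi_pos _).ne h
  · exact ae_of_all _ fun x => (Real.exp_pos _).le

/-- The surface area of the unit sphere. -/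
theorem toSphere_univ_eq [Nontrivial E] :
    (volume : Measure E).toSphere univ =
      ENNReal.ofReal (Real.pi ^ ((Module.finrank ℝ E : ℝ) / 2) /
        (Real.Gamma ((Module.finrank ℝ E : ℝ) / 2) / 2)) := by
  have hn : 0 < Module.finrank ℝ E := Module.finrank_pos
  have h := lintegral_homogeneous_mul_gaussian (E := E) (φ := fun _ => 1) measurable_const 0
    (by simp)
  simp only [one_mul, lintegral_gaussian, lintegral_one, Nat.cast_zero, add_zero] at h
  have g1 := Real.Gamma_pos_of_pos (s := (Module.finrank ℝ E : ℝ) / 2) (by positivity)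
  exact eq_ofReal_div_of_mul_ofReal_eq (by positivity) h.symm

/-- The mean norm of the projection of a point of the unit sphere to a subspace. -/
theorem lintegral_toSphere_norm_projection [Nontrivial E] (K : Submodule ℝ E) [Nontrivial K] :
    ∫⁻ u : Metric.sphere (0 : E) 1, ENNReal.ofReal ‖K.orthogonalProjectionOnto (u : E)‖
        ∂(volume : Measure E).toSphere =
      (volume : Measure E).toSphere univ * ENNReal.ofReal
        (Real.Gamma (((Module.finrank ℝ K : ℝ) + 1) / 2) * Real.Gamma ((Module.finrank ℝ E : ℝ) / 2)
          / (Real.Gamma ((Module.finrank ℝ K : ℝ) / 2) *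
            Real.Gamma (((Module.finrank ℝ E : ℝ) + 1) / 2))) := by
  have hn : 0 < Module.finrank ℝ E := Module.finrank_pos
  have hk : 0 < Module.finrank ℝ K := Module.finrank_pos
  have hadd := K.finrank_add_finrank_orthogonal
  have h1 := lintegral_homogeneous_mul_gaussian (E := E)
    (φ := fun x => ENNReal.ofReal ‖K.orthogonalProjectionOnto x‖) (by fun_prop) 1
    (by
      intro r hr x
      rw [map_smul, norm_smul, Real.norm_of_nonneg hr.le, ENNReal.ofReal_mul hr.le, pow_one])
  have h2 := lintegral_homogeneous_mul_gaussian (E := K)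
    (φ := fun x => ENNReal.ofReal ‖x‖) (by fun_prop) 1
    (by
      intro r hr x
      rw [norm_smul, Real.norm_of_nonneg hr.le, ENNReal.ofReal_mul hr.le, pow_one])
  rw [lintegral_gaussian_orthogonal K (φ := fun y => ENNReal.ofReal ‖y‖) (by fun_prop), h2,
    lintegral_gaussian] at h1
  simp only [norm_eq_of_mem_sphere, ENNReal.ofReal_one, lintegral_one, Nat.cast_one] at h1
  have g1 := Real.Gamma_pos_of_pos (s := (Module.finrank ℝ E : ℝ) / 2) (by positivity)
  have g2 := Real.Gamma_pos_of_pos (s := (Module.finrank ℝ K : ℝ) / 2) (by positivity)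
  have g3 := Real.Gamma_pos_of_pos (s := ((Module.finrank ℝ E : ℝ) + 1) / 2) (by positivity)
  have g4 := Real.Gamma_pos_of_pos (s := ((Module.finrank ℝ K : ℝ) + 1) / 2) (by positivity)
  have hpi : Real.pi ^ ((Module.finrank ℝ E : ℝ) / 2) =
      Real.pi ^ ((Module.finrank ℝ K : ℝ) / 2) * Real.pi ^ ((Module.finrank ℝ Kᗮ : ℝ) / 2) := by
    rw [← Real.rpow_add Real.pi_pos, ← hadd]
    push_cast
    ring_nf
  rw [toSphere_univ_eq, ← ENNReal.ofReal_mul (by positivity), ← ENNReal.ofReal_mul (by positivity)]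
    at h1
  rw [eq_ofReal_div_of_mul_ofReal_eq (by positivity) h1.symm, toSphere_univ_eq,
    ← ENNReal.ofReal_mul (by positivity), hpi]
  congr 1
  field_simp

/-- Integration of a function of the cosine in terms of the cosine. -/
theorem lintegral_sin_pow_mul_comp_cos (k : ℕ) (g : ℝ → ENNReal) :
    ∫⁻ θ in Ioo 0 Real.pi, ENNReal.ofReal (Real.sin θ ^ (k + 1)) * g (Real.cos θ) =
      ∫⁻ y in Ioo (-1 : ℝ) 1, ENNReal.ofReal ((1 - y ^ 2) ^ ((k : ℝ) / 2)) * g y := by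
  have himg : Real.cos '' Ioo 0 Real.pi = Ioo (-1) 1 := by
    ext y
    constructor
    · rintro ⟨θ, hθ, rfl⟩
      refine ⟨?_, ?_⟩
      · rw [← Real.cos_pi]
        exact Real.strictAntiOn_cos ⟨hθ.1.le, hθ.2.le⟩ ⟨Real.pi_pos.le, le_rfl⟩ hθ.2
      · rw [← Real.cos_zero]
        exact Real.strictAntiOn_cos ⟨le_rfl, Real.pi_pos.le⟩ ⟨hθ.1.le, hθ.2.le⟩ hθ.1
    · rintro ⟨h1, h2⟩
      exact ⟨Real.arccos y, ⟨Real.arccos_pos.2 h2, Real.arccos_lt_pi.2 h1⟩,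
        Real.cos_arccos h1.le h2.le⟩
  rw [← himg, lintegral_image_eq_lintegral_abs_deriv_mul measurableSet_Ioo
    (fun θ _ => (Real.hasDerivAt_cos θ).hasDerivWithinAt)
    (Real.injOn_cos.mono Ioo_subset_Icc_self)]
  refine setLIntegral_congr_fun measurableSet_Ioo fun θ hθ => ?_
  have hs : 0 < Real.sin θ := Real.sin_pos_of_pos_of_lt_pi hθ.1 hθ.2
  rw [abs_neg, abs_of_pos hs, ← Real.sin_sq, ← mul_assoc, ← ENNReal.ofReal_mul hs.le, pow_succ',
    ← Real.rpow_natCast (Real.sin θ) 2, ← Real.rpow_mul hs.le]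
  rw [show ((2 : ℕ) : ℝ) * ((k : ℝ) / 2) = k by push_cast; ring, Real.rpow_natCast]

/-- The Gaussian integral over a half plane of a function of the cosine, with a power weight. -/
theorem lintegral_halfPlane (k : ℕ) {g : ℝ → ENNReal} (hg : Measurable g) :
    ∫⁻ t : ℝ, ∫⁻ r in Ioi (0 : ℝ), ENNReal.ofReal (r ^ (k + 1)) *
        (g (t / √(t ^ 2 + r ^ 2)) * ENNReal.ofReal (Real.exp (-(t ^ 2 + r ^ 2)))) =
      ENNReal.ofReal (Real.Gamma (((k : ℝ) + 3) / 2) / 2) *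
        ∫⁻ y in Ioo (-1 : ℝ) 1, ENNReal.ofReal ((1 - y ^ 2) ^ ((k : ℝ) / 2)) * g y := by
  let ψ : ℝ × ℝ → ENNReal := fun p => (Ioi (0 : ℝ)).indicator (fun _ => 1) p.2 *
    (ENNReal.ofReal (p.2 ^ (k + 1)) * (g (p.1 / √(p.1 ^ 2 + p.2 ^ 2)) *
      ENNReal.ofReal (Real.exp (-(p.1 ^ 2 + p.2 ^ 2)))))
  have hind : Measurable ((Ioi (0 : ℝ)).indicator (fun _ => (1 : ENNReal))) :=
    measurable_const.indicator measurableSet_Ioi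
  have hψ : Measurable ψ := by fun_prop
  have h1 : ∫⁻ p, ψ p = ∫⁻ t : ℝ, ∫⁻ r in Ioi (0 : ℝ), ENNReal.ofReal (r ^ (k + 1)) *
        (g (t / √(t ^ 2 + r ^ 2)) * ENNReal.ofReal (Real.exp (-(t ^ 2 + r ^ 2)))) := by
    rw [Measure.volume_eq_prod, lintegral_prod _ hψ.aemeasurable]
    refine lintegral_congr fun t => ?_
    rw [← lintegral_indicator measurableSet_Ioi]
    refine lintegral_congr fun r => ?_
    by_cases hr : r ∈ Ioi (0 : ℝ) <;> simp [ψ, hr]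
  have h2 : ∀ p ∈ polarCoord.target, ENNReal.ofReal p.1 • ψ (polarCoord.symm p) =
      (ENNReal.ofReal (p.1 ^ (k + 2)) * ENNReal.ofReal (Real.exp (-p.1 ^ 2))) *
        (Ioo 0 Real.pi).indicator
          (fun θ => ENNReal.ofReal (Real.sin θ ^ (k + 1)) * g (Real.cos θ)) p.2 := by
    rintro ⟨r, θ⟩ ⟨hr, hθ⟩
    simp only [mem_Ioi] at hr
    simp only [mem_Ioo] at hθ
    simp only [polarCoord_symm_apply, ψ, smul_eq_mul]
    by_cases hθ0 : 0 < θ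
    · have hs : 0 < Real.sin θ := Real.sin_pos_of_pos_of_lt_pi hθ0 hθ.2
      have hsq : (r * Real.cos θ) ^ 2 + (r * Real.sin θ) ^ 2 = r ^ 2 := by
        linear_combination r ^ 2 * Real.sin_sq_add_cos_sq θ
      rw [indicator_of_mem (show r * Real.sin θ ∈ Ioi (0 : ℝ) from mul_pos hr hs),
        indicator_of_mem (show θ ∈ Ioo 0 Real.pi from ⟨hθ0, hθ.2⟩), hsq, Real.sqrt_sq hr.le,
        mul_div_cancel_left₀ _ hr.ne', mul_pow, ENNReal.ofReal_mul (by positivity),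
        show k + 2 = (k + 1) + 1 by ring, pow_succ r (k + 1), ENNReal.ofReal_mul (by positivity)]
      ring
    · have hs : Real.sin θ ≤ 0 := Real.sin_nonpos_of_nonpos_of_neg_pi_le (not_lt.1 hθ0) hθ.1.le
      rw [indicator_of_notMem (show r * Real.sin θ ∉ Ioi (0 : ℝ) from
          not_lt.2 (mul_nonpos_of_nonneg_of_nonpos hr.le hs)),
        indicator_of_notMem (show θ ∉ Ioo 0 Real.pi from fun h => hθ0 h.1)]
      simp
  have hm : Measurable ((Ioo 0 Real.pi).indicator
      (fun θ => ENNReal.ofReal (Real.sin θ ^ (k + 1)) * g (Real.cos θ))) :=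
    Measurable.indicator (by fun_prop) measurableSet_Ioo
  rw [← h1, ← lintegral_comp_polarCoord_symm, setLIntegral_congr_fun
    polarCoord.open_target.measurableSet h2, polarCoord_target, Measure.volume_eq_prod,
    ← Measure.prod_restrict, lintegral_prod_mul
    (f := fun r : ℝ => ENNReal.ofReal (r ^ (k + 2)) * ENNReal.ofReal (Real.exp (-r ^ 2)))
    (by fun_prop) hm.aemeasurable,
    lintegral_pow_mul_exp_neg_sq, lintegral_indicator measurableSet_Ioo,
    Measure.restrict_restrict measurableSet_Ioo,
    inter_eq_left.2 (Ioo_subset_Ioo_left (neg_nonpos.2 Real.pi_pos.le)),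
    lintegral_sin_pow_mul_comp_cos]
  congr 4
  push_cast
  ring

/-- The law of the inner product of a fixed unit vector with a point on the sphere. -/
theorem lintegral_toSphere_comp_inner {k : ℕ} (hk : Module.finrank ℝ E = k + 3) {x : E}
    (hx : ‖x‖ = 1) {g : ℝ → ENNReal} (hg : Measurable g) :
    ∫⁻ u : Metric.sphere (0 : E) 1, g (inner ℝ x (u : E)) ∂(volume : Measure E).toSphere =
      (volume : Measure E).toSphere univ *
        ∫⁻ y in Ioo (-1 : ℝ) 1, ENNReal.ofReal (Real.Gamma (((k : ℝ) + 3) / 2) /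
          (√Real.pi * Real.Gamma (((k : ℝ) + 2) / 2)) * (1 - y ^ 2) ^ ((k : ℝ) / 2)) * g y := by
  have : Nontrivial E := Module.nontrivial_of_finrank_pos (R := ℝ) (by omega)
  let K : Submodule ℝ E := ℝ ∙ x
  have hx0 : x ≠ 0 := by
    rintro rfl
    simp at hx
  have hadd := K.finrank_add_finrank_orthogonal
  have hK : Module.finrank ℝ K = 1 := finrank_span_singleton hx0
  have hKo : Module.finrank ℝ Kᗮ = k + 2 := by omega
  have : Nontrivial Kᗮ := Module.nontrivial_of_finrank_pos (R := ℝ) (by omega)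
  let ψ : ℝ → ℝ → ENNReal := fun t r =>
    g (t / √(t ^ 2 + r ^ 2)) * ENNReal.ofReal (Real.exp (-(t ^ 2 + r ^ 2)))
  have hψ : Measurable (Function.uncurry ψ) := by
    simp only [ψ, Function.uncurry_def]
    fun_prop
  have h1 := lintegral_homogeneous_mul_gaussian (E := E)
    (φ := fun v => g (inner ℝ x v / ‖v‖)) (by fun_prop) 0
    (by
      intro r hr v
      rw [inner_smul_right, norm_smul, Real.norm_of_nonneg hr.le, mul_div_mul_left _ _ hr.ne']
      simp)
  have h2 := lintegral_orthogonal K (φ := fun p => ψ (inner ℝ x (p.1 : E)) ‖p.2‖)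
    (hψ.comp (by fun_prop : Measurable fun p : K × Kᗮ => (inner ℝ x (p.1 : E), ‖p.2‖)))
  have h3 : ∀ v : E, ψ (inner ℝ x (K.orthogonalProjectionOnto v : E))
      ‖Kᗮ.orthogonalProjectionOnto v‖ =
        g (inner ℝ x v / ‖v‖) * ENNReal.ofReal (Real.exp (-‖v‖ ^ 2)) := by
    intro v
    have hp : (K.orthogonalProjectionOnto v : E) = (inner ℝ x v) • x :=
      Submodule.starProjection_unit_singleton ℝ hx v
    have hn := K.norm_sq_eq_add_norm_sq_projection v
    have hpn : ‖K.orthogonalProjectionOnto v‖ ^ 2 = (inner ℝ x v) ^ 2 := by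
      rw [show ‖K.orthogonalProjectionOnto v‖ = ‖(K.orthogonalProjectionOnto v : E)‖ from rfl, hp,
        norm_smul, hx, mul_one, Real.norm_eq_abs, sq_abs]
    have hi : inner ℝ x (K.orthogonalProjectionOnto v : E) = inner ℝ x v := by
      rw [hp, inner_smul_right, real_inner_self_eq_norm_sq, hx]
      ring
    simp only [ψ]
    rw [hi, ← hpn, ← hn, Real.sqrt_sq (norm_nonneg _)]
  have h4 : ∀ y : K, ∫⁻ z : Kᗮ, ψ (inner ℝ x (y : E)) ‖z‖ =
      (∫⁻ r in Ioi (0 : ℝ), ENNReal.ofReal (r ^ (k + 1)) * ψ (inner ℝ x (y : E)) r) *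
        (volume : Measure Kᗮ).toSphere univ := by
    intro y
    rw [lintegral_polar (f := fun z : Kᗮ => ψ (inner ℝ x (y : E)) ‖z‖)
      (hψ.comp (by fun_prop : Measurable fun z : Kᗮ => (inner ℝ x (y : E), ‖z‖))),
      ← lintegral_const, hKo]
    refine lintegral_congr fun u => setLIntegral_congr_fun measurableSet_Ioi fun r hr => ?_
    have hr' : (0 : ℝ) < r := hr
    simp [norm_smul, abs_of_pos hr']
  have h5 : ∫⁻ y : K, (∫⁻ r in Ioi (0 : ℝ), ENNReal.ofReal (r ^ (k + 1)) *
        ψ (inner ℝ x (y : E)) r) =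
      ∫⁻ t : ℝ, ∫⁻ r in Ioi (0 : ℝ), ENNReal.ofReal (r ^ (k + 1)) * ψ t r := by
    have hT := (LinearIsometryEquiv.toSpanUnitSingleton (𝕜 := ℝ) x hx).measurePreserving
    have := hT.lintegral_comp_emb
      (LinearIsometryEquiv.toSpanUnitSingleton (𝕜 := ℝ) x hx).toHomeomorph.measurableEmbedding
      (fun y : K => ∫⁻ r in Ioi (0 : ℝ), ENNReal.ofReal (r ^ (k + 1)) * ψ (inner ℝ x (y : E)) r)
    rw [← this]
    refine lintegral_congr fun t => ?_
    have hi : inner ℝ x (((LinearIsometryEquiv.toSpanUnitSingleton (𝕜 := ℝ) x hx t) : K) : E)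
        = t := by
      rw [LinearIsometryEquiv.toSpanUnitSingleton_apply]
      simp [inner_smul_right, hx]
    simp only [hi]
  have hmeas : Measurable fun y : K => ∫⁻ r in Ioi (0 : ℝ), ENNReal.ofReal (r ^ (k + 1)) *
        ψ (inner ℝ x (y : E)) r := by
    refine Measurable.lintegral_prod_right' (f := fun p : K × ℝ =>
      ENNReal.ofReal (p.2 ^ (k + 1)) * ψ (inner ℝ x (p.1 : E)) p.2) ?_
    exact Measurable.mul (by fun_prop)
      (hψ.comp (by fun_prop : Measurable fun p : K × ℝ => (inner ℝ x (p.1 : E), p.2)))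
  simp only [h3, h4] at h2
  rw [lintegral_mul_const _ hmeas, h5, h1, lintegral_halfPlane k hg, hk] at h2
  simp only [norm_eq_of_mem_sphere, div_one, Nat.cast_zero, add_zero] at h2
  have g1 := Real.Gamma_pos_of_pos (s := ((k : ℝ) + 3) / 2) (by positivity)
  have g2 := Real.Gamma_pos_of_pos (s := ((k : ℝ) + 2) / 2) (by positivity)
  have hcast : (((k + 3 : ℕ) : ℝ)) = (k : ℝ) + 3 := by push_cast; ring
  have hcast2 : (((k + 2 : ℕ) : ℝ)) = (k : ℝ) + 2 := by push_cast; ring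
  rw [hcast, mul_comm, mul_assoc] at h2
  have h6 := (ENNReal.mul_right_inj (by simpa using g1) ENNReal.ofReal_ne_top).1 h2
  rw [h6, toSphere_univ_eq, toSphere_univ_eq, hk, hKo, hcast, hcast2, mul_comm]
  have hpi : Real.pi ^ (((k : ℝ) + 3) / 2) = Real.pi ^ (((k : ℝ) + 2) / 2) * √Real.pi := by
    rw [Real.sqrt_eq_rpow, ← Real.rpow_add Real.pi_pos]
    ring_nf
  rw [← lintegral_const_mul _ (by fun_prop), ← lintegral_const_mul _ (by fun_prop)]
  refine setLIntegral_congr_fun measurableSet_Ioo fun y hy => ?_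
  rw [← mul_assoc, ← mul_assoc, ← ENNReal.ofReal_mul (by positivity),
    ← ENNReal.ofReal_mul (by positivity), hpi]
  congr 2
  field_simp

end Sphere

section Law

theorem toSphere_univ_ne_zero (ι : Type*) [Fintype ι] [Nonempty ι] :
    (volume : Measure (EuclideanSpace ℝ ι)).toSphere univ ≠ 0 :=
  Measure.measure_univ_ne_zero.2 (Measure.toSphere_ne_zero _)

instance isProbabilityMeasure_sphereUniform {ι : Type*} [Fintype ι] [Nonempty ι] :
    IsProbabilityMeasure (sphereUniform ι) := by
  constructor
  rw [sphereUniform, Measure.smul_apply, smul_eq_mul]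
  exact ENNReal.inv_mul_cancel (toSphere_univ_ne_zero ι) (measure_ne_top _ _)

theorem lintegral_sphereUniform {ι : Type*} [Fintype ι] (φ : USphere ι → ENNReal) :
    ∫⁻ u, φ u ∂sphereUniform ι =
      ((volume : Measure (EuclideanSpace ℝ ι)).toSphere univ)⁻¹ *
        ∫⁻ u, φ u ∂(volume : Measure (EuclideanSpace ℝ ι)).toSphere := by
  rw [sphereUniform, lintegral_smul_measure, smul_eq_mul]

theorem inv_toSphere_univ_mul_cancel {ι : Type*} [Fintype ι] [Nonempty ι] (a : ENNReal) :
    ((volume : Measure (EuclideanSpace ℝ ι)).toSphere univ)⁻¹ *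
      ((volume : Measure (EuclideanSpace ℝ ι)).toSphere univ * a) = a := by
  rw [← mul_assoc, ENNReal.inv_mul_cancel (toSphere_univ_ne_zero ι)
    (measure_ne_top _ _), one_mul]

variable {n : ℕ}

theorem lintegral_sphereUniform_comp_inner (hn : 3 ≤ n) (x : USphere (Fin n)) {g : ℝ → ENNReal}
    (hg : Measurable g) :
    ∫⁻ u, g (inner ℝ (x : EuclideanSpace ℝ (Fin n)) (u : EuclideanSpace ℝ (Fin n)))
        ∂sphereUniform (Fin n) =
      ∫⁻ y in Icc (-1 : ℝ) 1, ENNReal.ofReal (cosDensity n y) * g y := by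
  obtain ⟨k, rfl⟩ := Nat.exists_eq_add_of_le' hn
  rw [lintegral_sphereUniform, lintegral_toSphere_comp_inner (k := k) (by simp) (by simp) hg,
    inv_toSphere_univ_mul_cancel, Measure.restrict_congr_set Ioo_ae_eq_Icc]
  refine lintegral_congr fun y => ?_
  rw [cosDensity, cosConst]
  push_cast
  rw [show (k : ℝ) + 3 - 1 = k + 2 by ring, show (k : ℝ) + 3 - 3 = k by ring]

theorem continuous_cosDensity (hn : 3 ≤ n) : Continuous (cosDensity n) := by
  have h : (0 : ℝ) ≤ ((n : ℝ) - 3) / 2 := by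
    have : (3 : ℝ) ≤ n := by exact_mod_cast hn
    linarith
  exact continuous_const.mul ((by fun_prop : Continuous fun y : ℝ => 1 - y ^ 2).rpow_const
    fun _ => Or.inr h)

theorem cosDensity_nonneg (hn : 3 ≤ n) {y : ℝ} (hy : y ∈ Icc (-1 : ℝ) 1) :
    0 ≤ cosDensity n y := by
  have h3 : (3 : ℝ) ≤ n := by exact_mod_cast hn
  have g1 := Real.Gamma_pos_of_pos (s := (n : ℝ) / 2) (by linarith)
  have g2 := Real.Gamma_pos_of_pos (s := ((n : ℝ) - 1) / 2) (by linarith)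
  have hy' : 0 ≤ 1 - y ^ 2 := by nlinarith [hy.1, hy.2]
  unfold cosDensity cosConst
  positivity

theorem map_inner_sphereUniform (hn : 3 ≤ n) (x : USphere (Fin n)) :
    (sphereUniform (Fin n)).map (fun u : USphere (Fin n) =>
        inner ℝ (x : EuclideanSpace ℝ (Fin n)) (u : EuclideanSpace ℝ (Fin n))) =
      (volume.restrict (Icc (-1 : ℝ) 1)).withDensity
        (fun y => ENNReal.ofReal (cosDensity n y)) := by
  ext s hs
  have hm : Measurable (s.indicator (1 : ℝ → ENNReal)) := measurable_one.indicator hs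
  have hX : Measurable fun u : USphere (Fin n) =>
        inner ℝ (x : EuclideanSpace ℝ (Fin n)) (u : EuclideanSpace ℝ (Fin n)) := by fun_prop
  rw [← lintegral_indicator_one hs, lintegral_map hm hX,
    lintegral_sphereUniform_comp_inner hn x hm, withDensity_apply _ hs, ← lintegral_indicator hs]
  refine lintegral_congr fun y => ?_
  by_cases hy : y ∈ s <;> simp [hy]

theorem sphereUniform_real_inner_le (hn : 3 ≤ n) (x : USphere (Fin n)) {y : ℝ}
    (hy : y ∈ Icc (-1 : ℝ) 1) :
    (sphereUniform (Fin n)).real {u : USphere (Fin n) |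
      inner ℝ (x : EuclideanSpace ℝ (Fin n)) (u : EuclideanSpace ℝ (Fin n)) ≤ y} =
      cosCDF n y := by
  have hX : Measurable fun u : USphere (Fin n) =>
        inner ℝ (x : EuclideanSpace ℝ (Fin n)) (u : EuclideanSpace ℝ (Fin n)) := by fun_prop
  have h1 : (sphereUniform (Fin n)) {u : USphere (Fin n) |
      inner ℝ (x : EuclideanSpace ℝ (Fin n)) (u : EuclideanSpace ℝ (Fin n)) ≤ y} =
      ((sphereUniform (Fin n)).map (fun u : USphere (Fin n) =>
        inner ℝ (x : EuclideanSpace ℝ (Fin n)) (u : EuclideanSpace ℝ (Fin n)))) (Iic y) := by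
    rw [Measure.map_apply hX measurableSet_Iic]
    rfl
  have hset : Iic y ∩ Icc (-1 : ℝ) 1 = Icc (-1) y := by
    ext t
    simp only [mem_inter_iff, mem_Iic, mem_Icc]
    constructor
    · rintro ⟨h1, h2, -⟩
      exact ⟨h2, h1⟩
    · rintro ⟨h1, h2⟩
      exact ⟨h2, h1, h2.trans hy.2⟩
  rw [measureReal_def, h1, map_inner_sphereUniform hn, withDensity_apply _ measurableSet_Iic,
    Measure.restrict_restrict measurableSet_Iic, hset, Measure.restrict_congr_set Ioc_ae_eq_Icc.symm,
    cosCDF, intervalIntegral.integral_of_le hy.1, integral_eq_lintegral_of_nonneg_ae]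
  · filter_upwards [ae_restrict_mem measurableSet_Ioc] with t ht
    exact cosDensity_nonneg hn ⟨ht.1.le, ht.2.trans hy.2⟩
  · exact (continuous_cosDensity hn).aestronglyMeasurable

theorem hasDerivAt_cosCDF (hn : 3 ≤ n) (y : ℝ) : HasDerivAt (cosCDF n) (cosDensity n y) y :=
  intervalIntegral.integral_hasDerivAt_right
    ((continuous_cosDensity hn).intervalIntegrable _ _)
    (continuous_cosDensity hn).stronglyMeasurable.stronglyMeasurableAtFilter
    (continuous_cosDensity hn).continuousAt

theorem continuous_cosCDF (hn : 3 ≤ n) : Continuous (cosCDF n) :=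
  continuous_iff_continuousAt.2 fun y => (hasDerivAt_cosCDF hn y).continuousAt

theorem cosCDF_neg_one : cosCDF n (-1) = 0 := by
  simp [cosCDF]

theorem nonempty_uSphere (hn : 3 ≤ n) : Nonempty (USphere (Fin n)) := by
  have : Nonempty (Fin n) := ⟨⟨0, by omega⟩⟩
  exact nonempty_of_isProbabilityMeasure (sphereUniform (Fin n))

theorem abs_inner_uSphere_le_one {ι : Type*} [Fintype ι] (x u : USphere ι) :
    |inner ℝ (x : EuclideanSpace ℝ ι) (u : EuclideanSpace ℝ ι)| ≤ 1 := by
  simpa using abs_real_inner_le_norm (x : EuclideanSpace ℝ ι) (u : EuclideanSpace ℝ ι)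

theorem cosCDF_one (hn : 3 ≤ n) : cosCDF n 1 = 1 := by
  have : Nonempty (Fin n) := ⟨⟨0, by omega⟩⟩
  obtain ⟨x⟩ := nonempty_uSphere hn
  rw [← sphereUniform_real_inner_le hn x (by norm_num)]
  convert probReal_univ (μ := sphereUniform (Fin n))
  ext u
  simpa using (abs_le.1 (abs_inner_uSphere_le_one x u)).2

/-- The mean of the maximum of `m` independent cosines, in terms of the distribution function. -/
theorem natCast_mul_integral_mul_cosCDF_pow (hn : 3 ≤ n) {m : ℕ} (hm : 1 ≤ m) :
    (m : ℝ) * ∫ y in (-1 : ℝ)..1, y * cosCDF n y ^ (m - 1) * cosDensity n y =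
      1 - ∫ y in (-1 : ℝ)..1, cosCDF n y ^ m := by
  have hF := continuous_cosCDF hn
  have hf := continuous_cosDensity hn
  have h := intervalIntegral.integral_mul_deriv_eq_deriv_mul (a := (-1 : ℝ)) (b := 1)
    (u := fun y => y) (v := fun y => cosCDF n y ^ m) (u' := fun _ => 1)
    (v' := fun y => m * cosCDF n y ^ (m - 1) * cosDensity n y)
    (fun y _ => hasDerivAt_id y) (fun y _ => (hasDerivAt_cosCDF hn y).pow m)
    (by simp) ((by fun_prop : Continuous fun y : ℝ =>
      (m : ℝ) * cosCDF n y ^ (m - 1) * cosDensity n y).intervalIntegrable _ _)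
  simp only [cosCDF_one hn, cosCDF_neg_one, one_pow, one_mul, zero_pow (show m ≠ 0 by omega),
    mul_zero, sub_zero] at h
  rw [← h, ← intervalIntegral.integral_const_mul]
  refine intervalIntegral.integral_congr fun y _ => ?_
  ring

/-- The mean of a random variable with values in `[-1, 1]` in terms of its distribution
function. -/
theorem integral_eq_one_sub_integral_cdf {Ω : Type*} [MeasurableSpace Ω] {μ : Measure Ω}
    [IsProbabilityMeasure μ] {X : Ω → ℝ} (hX : Measurable X) (hb : ∀ ω, |X ω| ≤ 1) :
    ∫ ω, X ω ∂μ = 1 - ∫ y in (-1 : ℝ)..1, μ.real {ω | X ω ≤ y} := by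
  have hXi : Integrable X μ := Integrable.of_bound hX.aestronglyMeasurable 1 (ae_of_all _ hb)
  have h := Integrable.integral_eq_integral_Ioc_meas_le (μ := μ) (f := fun ω => 1 - X ω) (M := 2)
    ((integrable_const _).sub hXi) (ae_of_all _ fun ω => by
      simpa using (abs_le.1 (hb ω)).2)
    (ae_of_all _ fun ω => by
      have := (abs_le.1 (hb ω)).1
      simp only
      linarith)
  rw [integral_sub (integrable_const _) hXi, ← intervalIntegral.integral_of_le (by norm_num)] at h
  have h2 := intervalIntegral.integral_comp_sub_left (a := 0) (b := 2)
    (fun y => μ.real {ω | X ω ≤ y}) 1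
  norm_num at h2
  have h3 : ∀ t : ℝ, {a | t ≤ 1 - X a} = {ω | X ω ≤ 1 - t} := fun t => by
    ext ω
    simp only [mem_ofPred_eq]
    constructor <;> intro h <;> linarith
  simp only [h3, integral_const, probReal_univ, smul_eq_mul, mul_one] at h
  rw [h2] at h
  linarith

end Law

section Configuration

/-- The largest inner product of `y` with a member of the family `S`. -/
def maxInner {E : Type*} [NormedAddCommGroup E] [InnerProductSpace ℝ E] {κ : Type*} [Fintype κ]
    [Nonempty κ] (S : κ → E) (y : E) : ℝ :=
  Finset.univ.sup' Finset.univ_nonempty fun i => inner ℝ (S i) y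

theorem refCos_eq_maxInner {E : Type*} [NormedAddCommGroup E] [InnerProductSpace ℝ E] {κ : Type*}
    [Fintype κ] [Nonempty κ] (S : κ → E) (v : E) : refCos S v = maxInner S v := by
  have h : ∃ i, ∀ j, inner ℝ (S j) v ≤ inner ℝ (S i) v :=
    Finite.exists_max fun i => inner ℝ (S i) v
  rw [refCos, refVector, dif_pos h, real_inner_comm]
  exact le_antisymm (Finset.le_sup' (fun i => inner ℝ (S i) v) (Finset.mem_univ _))
    (Finset.sup'_le _ _ fun j _ => h.choose_spec j)

theorem maxInner_smul {E : Type*} [NormedAddCommGroup E] [InnerProductSpace ℝ E] {κ : Type*}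
    [Fintype κ] [Nonempty κ] (S : κ → E) (y : E) {r : ℝ} (hr : 0 ≤ r) :
    maxInner S (r • y) = r * maxInner S y := by
  simp only [maxInner, inner_smul_right]
  exact (Finset.mul₀_sup' hr _ _ _).symm

theorem maxInner_le_iff {E : Type*} [NormedAddCommGroup E] [InnerProductSpace ℝ E] {κ : Type*}
    [Fintype κ] [Nonempty κ] {S : κ → E} {y : E} {a : ℝ} :
    maxInner S y ≤ a ↔ ∀ i, inner ℝ (S i) y ≤ a := by
  simp [maxInner, Finset.sup'_le_iff]

theorem abs_maxInner_le_one {ι κ : Type*} [Fintype ι] [Fintype κ] [Nonempty κ]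
    (w : κ → USphere ι) (x : USphere ι) :
    |maxInner (fun i => (w i : EuclideanSpace ℝ ι)) (x : EuclideanSpace ℝ ι)| ≤ 1 := by
  obtain ⟨i, -, hi⟩ := Finset.exists_mem_eq_sup' (Finset.univ_nonempty (α := κ))
    fun i => inner ℝ (w i : EuclideanSpace ℝ ι) (x : EuclideanSpace ℝ ι)
  rw [maxInner, hi]
  exact abs_inner_uSphere_le_one _ _

variable {L n : ℕ}

/-- The component at level `l`. -/
def block (l : Fin L) (v : EuclideanSpace ℝ (Fin L × Fin n)) : EuclideanSpace ℝ (Fin n) :=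
  WithLp.toLp 2 fun j => v (l, j)

/-- The inclusion of level `l`. -/
def blockIncl (l : Fin L) : EuclideanSpace ℝ (Fin n) →ₗᵢ[ℝ] EuclideanSpace ℝ (Fin L × Fin n) where
  toFun y := WithLp.toLp 2 fun p => if p.1 = l then y p.2 else 0
  map_add' x y := by
    ext p
    by_cases h : p.1 = l <;> simp [h]
  map_smul' r x := by
    ext p
    by_cases h : p.1 = l <;> simp [h]
  norm_map' x := by
    simp [EuclideanSpace.norm_eq, Fintype.sum_prod_type_right, apply_ite (fun t : ℝ => |t|), ite_pow]

theorem blockIncl_apply (l : Fin L) (y : EuclideanSpace ℝ (Fin n)) (p : Fin L × Fin n) :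
    blockIncl l y p = if p.1 = l then y p.2 else 0 := rfl

theorem norm_projection_range_blockIncl (l : Fin L) (v : EuclideanSpace ℝ (Fin L × Fin n)) :
    ‖(LinearMap.range (blockIncl (n := n) l).toLinearMap).orthogonalProjectionOnto v‖ =
      ‖block l v‖ := by
  have h : (LinearMap.range (blockIncl (n := n) l).toLinearMap).starProjection v =
      blockIncl l (block l v) := by
    refine Submodule.eq_starProjection_of_mem_of_inner_eq_zero ⟨block l v, rfl⟩ ?_
    rintro _ ⟨z, rfl⟩
    simp [PiLp.inner_apply, Fintype.sum_prod_type_right, blockIncl_apply, block]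
  have h2 := congrArg norm h
  rwa [LinearIsometry.norm_map] at h2

theorem continuous_block (l : Fin L) : Continuous (block (n := n) l) := by
  unfold block
  fun_prop

/-- The mean norm of the component at one level of a uniform point of the unit sphere of
`(ℝ^n)^L`. -/
def meanBlockNorm (n L : ℕ) : ℝ :=
  Real.Gamma (((n : ℝ) + 1) / 2) * Real.Gamma (((L * n : ℕ) : ℝ) / 2) /
    (Real.Gamma ((n : ℝ) / 2) * Real.Gamma ((((L * n : ℕ) : ℝ) + 1) / 2))

theorem meanBlockNorm_pos (hn : 3 ≤ n) (hL : 1 ≤ L) : 0 < meanBlockNorm n L := by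
  have hn' : (0 : ℝ) < n := by exact_mod_cast (by omega : 0 < n)
  have hd : (0 : ℝ) < ((L * n : ℕ) : ℝ) := by
    exact_mod_cast Nat.mul_pos hL (by omega)
  unfold meanBlockNorm
  have g1 := Real.Gamma_pos_of_pos (s := ((n : ℝ) + 1) / 2) (by positivity)
  have g2 := Real.Gamma_pos_of_pos (s := ((L * n : ℕ) : ℝ) / 2) (by positivity)
  have g3 := Real.Gamma_pos_of_pos (s := (n : ℝ) / 2) (by positivity)
  have g4 := Real.Gamma_pos_of_pos (s := (((L * n : ℕ) : ℝ) + 1) / 2) (by positivity)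
  positivity

theorem integral_norm_block (hn : 3 ≤ n) (hL : 1 ≤ L) (l : Fin L) :
    ∫ v : USphere (Fin L × Fin n), ‖block l (v : EuclideanSpace ℝ (Fin L × Fin n))‖
      ∂sphereUniform (Fin L × Fin n) = meanBlockNorm n L := by
  have : Nonempty (Fin n) := ⟨⟨0, by omega⟩⟩
  have : Nonempty (Fin L) := ⟨l⟩
  let K := LinearMap.range (blockIncl (n := n) l).toLinearMap
  have hK : Module.finrank ℝ K = n := by
    rw [LinearMap.finrank_range_of_inj (blockIncl (n := n) l).injective]
    simp
  have : Nontrivial K := Module.nontrivial_of_finrank_pos (R := ℝ) (by omega)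
  have h := lintegral_toSphere_norm_projection K
  rw [hK, finrank_euclideanSpace, Fintype.card_prod, Fintype.card_fin, Fintype.card_fin] at h
  have hcb := continuous_block (n := n) l
  rw [integral_eq_lintegral_of_nonneg_ae (ae_of_all _ fun v => norm_nonneg _)
    (by fun_prop : Continuous fun v : USphere (Fin L × Fin n) =>
      ‖block l (v : EuclideanSpace ℝ (Fin L × Fin n))‖).aestronglyMeasurable,
    lintegral_sphereUniform]
  simp only [K, norm_projection_range_blockIncl] at h
  rw [h, inv_toSphere_univ_mul_cancel, ENNReal.toReal_ofReal]
  · rfl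
  · exact (meanBlockNorm_pos hn hL).le

theorem inner_multiLevel {κ : Type*} (w : Fin L → κ → USphere (Fin n)) (k : Fin L → κ)
    (v : EuclideanSpace ℝ (Fin L × Fin n)) :
    inner ℝ (multiLevel w k) v =
      1 / √L * ∑ l, inner ℝ (w l (k l) : EuclideanSpace ℝ (Fin n)) (block l v) := by
  simp only [PiLp.inner_apply, multiLevel, block, Fintype.sum_prod_type, Finset.mul_sum]
  refine Finset.sum_congr rfl fun l _ => Finset.sum_congr rfl fun j _ => ?_
  simp only [RCLike.inner_apply, conj_trivial]
  ring

/-- The reference cosine of a multi-level configuration decouples over the levels. -/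
theorem refCos_multiLevel {κ : Type*} [Fintype κ] [Nonempty κ] (w : Fin L → κ → USphere (Fin n))
    (v : EuclideanSpace ℝ (Fin L × Fin n)) :
    refCos (multiLevel w) v =
      1 / √L * ∑ l, maxInner (fun i => (w l i : EuclideanSpace ℝ (Fin n))) (block l v) := by
  rw [refCos_eq_maxInner]
  have hL : 0 ≤ 1 / √(L : ℝ) := by positivity
  apply le_antisymm
  · rw [maxInner_le_iff]
    intro k
    rw [inner_multiLevel]
    refine mul_le_mul_of_nonneg_left (Finset.sum_le_sum fun l _ => ?_) hL
    exact Finset.le_sup' (fun i => inner ℝ (w l i : EuclideanSpace ℝ (Fin n)) (block l v))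
      (Finset.mem_univ _)
  · have h : ∀ l, ∃ i, maxInner (fun i => (w l i : EuclideanSpace ℝ (Fin n))) (block l v) =
        inner ℝ (w l i : EuclideanSpace ℝ (Fin n)) (block l v) := fun l => by
      obtain ⟨i, -, hi⟩ := Finset.exists_mem_eq_sup' (Finset.univ_nonempty (α := κ))
        fun i => inner ℝ (w l i : EuclideanSpace ℝ (Fin n)) (block l v)
      exact ⟨i, hi⟩
    choose k hk using h
    simp only [hk]
    rw [← inner_multiLevel]
    exact Finset.le_sup' (fun k => inner ℝ (multiLevel w k) v) (Finset.mem_univ k)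

theorem continuous_maxInner {X κ : Type*} [TopologicalSpace X] [Fintype κ] [Nonempty κ]
    {E : Type*} [NormedAddCommGroup E] [InnerProductSpace ℝ E] {S : X → κ → E} {y : X → E}
    (hS : ∀ i, Continuous fun x => S x i) (hy : Continuous y) :
    Continuous fun x => maxInner (S x) (y x) :=
  Continuous.finset_sup'_apply _ fun i _ => (hS i).inner hy

/-- The expected reference cosine of a random multi-level configuration whose levels are
independent copies of a random family, if the mean maximal cosine of that family with any given
unit vector is `M`. -/
theorem integral_J_multiLevel (hn : 3 ≤ n) (hL : 1 ≤ L) {κ₀ κ : Type*} [Fintype κ₀] [Fintype κ]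
    [Nonempty κ] {W : (κ₀ → USphere (Fin n)) → κ → USphere (Fin n)}
    (hW : ∀ i, Continuous fun ω => W ω i) {M : ℝ}
    (hM : ∀ x : USphere (Fin n),
      ∫ ω, maxInner (fun i => (W ω i : EuclideanSpace ℝ (Fin n))) (x : EuclideanSpace ℝ (Fin n))
        ∂(Measure.pi fun _ => sphereUniform (Fin n)) = M) :
    ∫ w : Fin L → κ₀ → USphere (Fin n), J (multiLevel fun l => W (w l))
      ∂(Measure.pi fun _ => Measure.pi fun _ => sphereUniform (Fin n)) =
        √L * meanBlockNorm n L * M := by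
  have : Nonempty (Fin n) := ⟨⟨0, by omega⟩⟩
  have : Nonempty (Fin L) := ⟨⟨0, by omega⟩⟩
  have hc : Continuous fun p : (Fin L → κ₀ → USphere (Fin n)) × USphere (Fin L × Fin n) =>
      1 / √(L : ℝ) * ∑ l, maxInner (fun i => (W (p.1 l) i : EuclideanSpace ℝ (Fin n)))
        (block l (p.2 : EuclideanSpace ℝ (Fin L × Fin n))) := by
    refine continuous_const.mul (continuous_finsetSum _ fun l _ => continuous_maxInner
      (fun i => ?_) ?_)
    · exact continuous_subtype_val.comp ((hW i).comp (by fun_prop))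
    · exact (continuous_block l).comp (by fun_prop)
  have hblock : ∀ y : EuclideanSpace ℝ (Fin n),
      ∫ ω, maxInner (fun i => (W ω i : EuclideanSpace ℝ (Fin n))) y
        ∂(Measure.pi fun _ => sphereUniform (Fin n)) = ‖y‖ * M := by
    intro y
    by_cases hy : y = 0
    · simp [hy, maxInner]
    · have hy' : ‖y‖ ≠ 0 := norm_ne_zero_iff.2 hy
      have hx : ‖y‖⁻¹ • y ∈ Metric.sphere (0 : EuclideanSpace ℝ (Fin n)) 1 := by
        simp [norm_smul, hy']
      have h := hM ⟨_, hx⟩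
      rw [← h, ← integral_const_mul]
      refine integral_congr_ae (ae_of_all _ fun ω => ?_)
      simp only
      rw [← maxInner_smul _ _ (norm_nonneg y), smul_smul, mul_inv_cancel₀ hy', one_smul]
  have hcω : ∀ y : EuclideanSpace ℝ (Fin n), Continuous fun ω =>
      maxInner (fun i => (W ω i : EuclideanSpace ℝ (Fin n))) y := fun y =>
    continuous_maxInner (fun i => continuous_subtype_val.comp (hW i)) continuous_const
  have hlevel : ∀ (l : Fin L) (y : EuclideanSpace ℝ (Fin n)),
      ∫ w : Fin L → κ₀ → USphere (Fin n),
        maxInner (fun i => (W (w l) i : EuclideanSpace ℝ (Fin n))) y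
        ∂(Measure.pi fun _ => Measure.pi fun _ => sphereUniform (Fin n)) = ‖y‖ * M := by
    intro l y
    have hp := measurePreserving_eval
      (fun _ : Fin L => Measure.pi fun _ : κ₀ => sphereUniform (Fin n)) l
    have h := integral_map
      (μ := Measure.pi fun _ : Fin L => Measure.pi fun _ : κ₀ => sphereUniform (Fin n))
      hp.measurable.aemeasurable (hcω y).aestronglyMeasurable
    rw [hp.map_eq, hblock y] at h
    exact h.symm
  simp only [J, refCos_multiLevel]
  rw [integral_integral_swap (hc.integrable_of_hasCompactSupport (HasCompactSupport.of_compactSpace _))]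
  have hint : ∀ (l : Fin L) (y : EuclideanSpace ℝ (Fin n)),
      Integrable (fun w : Fin L → κ₀ → USphere (Fin n) =>
        maxInner (fun i => (W (w l) i : EuclideanSpace ℝ (Fin n))) y)
        (Measure.pi fun _ => Measure.pi fun _ => sphereUniform (Fin n)) := fun l y =>
    ((hcω y).comp (continuous_apply l)).integrable_of_hasCompactSupport
      (HasCompactSupport.of_compactSpace _)
  simp only [integral_const_mul, integral_finsetSum _ fun l _ => hint l _, hlevel]
  rw [integral_finsetSum]
  · simp only [integral_mul_const, integral_norm_block hn hL, Finset.sum_const, Finset.card_univ,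
      Fintype.card_fin, nsmul_eq_mul]
    have hs : √(L : ℝ) ≠ 0 := by
      have : (0 : ℝ) < L := by exact_mod_cast hL
      positivity
    field_simp
    rw [Real.sq_sqrt (Nat.cast_nonneg _)]
  · intro l _
    exact (((continuous_block l).comp continuous_subtype_val).norm.mul
      continuous_const).integrable_of_hasCompactSupport (HasCompactSupport.of_compactSpace _)

end Configuration

section Maximum

variable {n : ℕ}

theorem pi_real_forall_mem {κ S : Type*} [Fintype κ] [MeasurableSpace S] (μ : Measure S)
    [IsProbabilityMeasure μ] (A : Set S) :
    (Measure.pi fun _ : κ => μ).real {ω | ∀ i, ω i ∈ A} = μ.real A ^ Fintype.card κ := by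
  have h : {ω : κ → S | ∀ i, ω i ∈ A} = univ.pi fun _ => A := by
    ext ω
    simp
  rw [h, measureReal_def, Measure.pi_pi, Finset.prod_const, Finset.card_univ, ENNReal.toReal_pow,
    measureReal_def]

theorem measurable_maxInner {κ₀ κ : Type*} [Fintype κ₀] [Fintype κ] [Nonempty κ]
    {W : (κ₀ → USphere (Fin n)) → κ → USphere (Fin n)} (hW : ∀ i, Continuous fun ω => W ω i)
    (x : EuclideanSpace ℝ (Fin n)) :
    Measurable fun ω => maxInner (fun i => (W ω i : EuclideanSpace ℝ (Fin n))) x :=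
  (continuous_maxInner (fun i => continuous_subtype_val.comp (hW i)) continuous_const).measurable

/-- The mean maximal cosine of `m` independent uniform points with a unit vector. -/
theorem integral_maxInner_uniform (hn : 3 ≤ n) {m : ℕ} [Nonempty (Fin m)] (x : USphere (Fin n)) :
    ∫ ω : Fin m → USphere (Fin n),
      maxInner (fun i => (ω i : EuclideanSpace ℝ (Fin n))) (x : EuclideanSpace ℝ (Fin n))
        ∂(Measure.pi fun _ => sphereUniform (Fin n)) =
      1 - ∫ y in (-1 : ℝ)..1, cosCDF n y ^ m := by
  have : Nonempty (Fin n) := ⟨⟨0, by omega⟩⟩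
  rw [integral_eq_one_sub_integral_cdf
    (measurable_maxInner (W := fun ω => ω) (fun i => continuous_apply i) _)
    (fun ω => abs_maxInner_le_one ω x)]
  congr 1
  refine intervalIntegral.integral_congr fun y hy => ?_
  rw [uIcc_of_le (by norm_num)] at hy
  have h := pi_real_forall_mem (κ := Fin m) (sphereUniform (Fin n)) {u : USphere (Fin n) |
    inner ℝ (x : EuclideanSpace ℝ (Fin n)) (u : EuclideanSpace ℝ (Fin n)) ≤ y}
  rw [sphereUniform_real_inner_le hn x hy, Fintype.card_fin] at h
  simp only [maxInner_le_iff, real_inner_comm (x : EuclideanSpace ℝ (Fin n))]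
  exact h

/-- The probability that the cosine with a fixed unit vector is at most `y` in absolute value. -/
def absCosCDF (n : ℕ) (y : ℝ) : ℝ :=
  ((volume.restrict (Icc (-1 : ℝ) 1)).withDensity
    (fun y => ENNReal.ofReal (cosDensity n y))).real (Icc (-y) y)

theorem sphereUniform_real_abs_inner_le (hn : 3 ≤ n) (x : USphere (Fin n)) (y : ℝ) :
    (sphereUniform (Fin n)).real {u : USphere (Fin n) |
      inner ℝ (x : EuclideanSpace ℝ (Fin n)) (u : EuclideanSpace ℝ (Fin n)) ≤ y ∧
      -inner ℝ (x : EuclideanSpace ℝ (Fin n)) (u : EuclideanSpace ℝ (Fin n)) ≤ y} =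
      absCosCDF n y := by
  have hX : Measurable fun u : USphere (Fin n) =>
        inner ℝ (x : EuclideanSpace ℝ (Fin n)) (u : EuclideanSpace ℝ (Fin n)) := by fun_prop
  rw [absCosCDF, ← map_inner_sphereUniform hn x, map_measureReal_apply hX measurableSet_Icc]
  congr 1
  ext u
  simp only [mem_ofPred_eq, mem_preimage, mem_Icc]
  constructor
  · rintro ⟨h1, h2⟩
    exact ⟨by linarith, h1⟩
  · rintro ⟨h1, h2⟩
    exact ⟨h2, by linarith⟩

theorem absCosCDF_nonneg (y : ℝ) : 0 ≤ absCosCDF n y := measureReal_nonneg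

theorem monotone_absCosCDF (hn : 3 ≤ n) : Monotone (absCosCDF n) := by
  have : Nonempty (Fin n) := ⟨⟨0, by omega⟩⟩
  obtain ⟨x⟩ := nonempty_uSphere hn
  intro a b hab
  rw [← sphereUniform_real_abs_inner_le hn x, ← sphereUniform_real_abs_inner_le hn x]
  exact measureReal_mono fun u hu => ⟨hu.1.trans hab, hu.2.trans hab⟩

theorem absCosCDF_le (hn : 3 ≤ n) {y : ℝ} (hy : y ∈ Icc (-1 : ℝ) 1) :
    absCosCDF n y ≤ max 0 (2 * cosCDF n y - 1) := by
  have : Nonempty (Fin n) := ⟨⟨0, by omega⟩⟩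
  obtain ⟨x⟩ := nonempty_uSphere hn
  rw [← sphereUniform_real_abs_inner_le hn x]
  by_cases hy0 : y < 0
  · refine le_max_of_le_left (le_of_eq ?_)
    convert measureReal_empty
    ext u
    simp only [mem_ofPred_eq, mem_empty_iff_false, iff_false, not_and]
    intro h1 h2
    linarith
  · refine le_max_of_le_right (le_of_eq ?_)
    have hm : MeasurableSet {u : USphere (Fin n) |
        inner ℝ ((-x : USphere (Fin n)) : EuclideanSpace ℝ (Fin n))
          (u : EuclideanSpace ℝ (Fin n)) ≤ y} :=
      measurableSet_le (by fun_prop) measurable_const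
    have h := measureReal_union_add_inter (μ := sphereUniform (Fin n)) (s := {u : USphere (Fin n) |
      inner ℝ (x : EuclideanSpace ℝ (Fin n)) (u : EuclideanSpace ℝ (Fin n)) ≤ y}) hm
    rw [sphereUniform_real_inner_le hn x hy, sphereUniform_real_inner_le hn (-x) hy] at h
    have hu : {u : USphere (Fin n) |
        inner ℝ (x : EuclideanSpace ℝ (Fin n)) (u : EuclideanSpace ℝ (Fin n)) ≤ y} ∪
        {u : USphere (Fin n) | inner ℝ ((-x : USphere (Fin n)) : EuclideanSpace ℝ (Fin n))
          (u : EuclideanSpace ℝ (Fin n)) ≤ y} = univ := by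
      ext u
      simp only [mem_union, mem_ofPred_eq, mem_univ, iff_true, coe_neg_sphere, inner_neg_left]
      by_contra! hc
      linarith [hc.1, hc.2]
    rw [hu, probReal_univ] at h
    have hi : {u : USphere (Fin n) |
        inner ℝ (x : EuclideanSpace ℝ (Fin n)) (u : EuclideanSpace ℝ (Fin n)) ≤ y ∧
        -inner ℝ (x : EuclideanSpace ℝ (Fin n)) (u : EuclideanSpace ℝ (Fin n)) ≤ y} =
        {u : USphere (Fin n) |
          inner ℝ (x : EuclideanSpace ℝ (Fin n)) (u : EuclideanSpace ℝ (Fin n)) ≤ y} ∩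
        {u : USphere (Fin n) | inner ℝ ((-x : USphere (Fin n)) : EuclideanSpace ℝ (Fin n))
          (u : EuclideanSpace ℝ (Fin n)) ≤ y} := by
      ext u
      simp only [mem_inter_iff, mem_ofPred_eq, coe_neg_sphere, inner_neg_left]
    rw [hi]
    linarith

theorem continuous_antipodal {κ : Type*} (i : κ ⊕ κ) :
    Continuous fun ω : κ → USphere (Fin n) => antipodal ω i := by
  rcases i with i | i
  · exact continuous_apply i
  · exact (continuous_apply i).neg

/-- The mean maximal cosine of `k` independent uniform points and their antipodes with a unit
vector. -/
theorem integral_maxInner_antipodal (hn : 3 ≤ n) {k : ℕ} [Nonempty (Fin k)] (x : USphere (Fin n)) :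
    ∫ ω : Fin k → USphere (Fin n),
      maxInner (fun i => (antipodal ω i : EuclideanSpace ℝ (Fin n)))
        (x : EuclideanSpace ℝ (Fin n)) ∂(Measure.pi fun _ => sphereUniform (Fin n)) =
      1 - ∫ y in (-1 : ℝ)..1, absCosCDF n y ^ k := by
  have : Nonempty (Fin n) := ⟨⟨0, by omega⟩⟩
  rw [integral_eq_one_sub_integral_cdf (measurable_maxInner continuous_antipodal _)
    (fun ω => abs_maxInner_le_one (antipodal ω) x)]
  congr 1
  refine intervalIntegral.integral_congr fun y _ => ?_
  have h := pi_real_forall_mem (κ := Fin k) (sphereUniform (Fin n)) {u : USphere (Fin n) |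
    inner ℝ (x : EuclideanSpace ℝ (Fin n)) (u : EuclideanSpace ℝ (Fin n)) ≤ y ∧
      -inner ℝ (x : EuclideanSpace ℝ (Fin n)) (u : EuclideanSpace ℝ (Fin n)) ≤ y}
  rw [sphereUniform_real_abs_inner_le hn x y, Fintype.card_fin] at h
  rw [← h]
  congr 1
  ext ω
  simp [maxInner_le_iff, antipodal, forall_and, real_inner_comm (x : EuclideanSpace ℝ (Fin n))]

theorem integral_absCosCDF_pow_lt (hn : 3 ≤ n) {k : ℕ} (hk : k ≠ 0) :
    ∫ y in (-1 : ℝ)..1, absCosCDF n y ^ k < ∫ y in (-1 : ℝ)..1, cosCDF n y ^ (k + k) := by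
  have hF := continuous_cosCDF hn
  have hmono : Monotone fun y => absCosCDF n y ^ k := fun a b hab =>
    pow_le_pow_left₀ (absCosCDF_nonneg a) (monotone_absCosCDF hn hab) k
  have hsq : ∀ t : ℝ, max 0 (2 * t - 1) ≤ t ^ 2 := fun t =>
    max_le (sq_nonneg t) (by nlinarith [sq_nonneg (t - 1)])
  calc ∫ y in (-1 : ℝ)..1, absCosCDF n y ^ k
      ≤ ∫ y in (-1 : ℝ)..1, max 0 (2 * cosCDF n y - 1) ^ k := by
        refine intervalIntegral.integral_mono_on (by norm_num) hmono.intervalIntegrable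
          ((by fun_prop : Continuous fun y => max 0 (2 * cosCDF n y - 1) ^ k).intervalIntegrable _ _)
          fun y hy => ?_
        exact pow_le_pow_left₀ (absCosCDF_nonneg y) (absCosCDF_le hn hy) k
    _ < ∫ y in (-1 : ℝ)..1, cosCDF n y ^ (k + k) := by
        refine intervalIntegral.integral_lt_integral_of_continuousOn_of_le_of_exists_lt
          (by norm_num) (by fun_prop) (by fun_prop) (fun y _ => ?_) ?_
        · rw [← two_mul, pow_mul]
          exact pow_le_pow_left₀ (le_max_left _ _) (hsq _) k
        · have h := intermediate_value_Icc (show (-1 : ℝ) ≤ 1 by norm_num) hF.continuousOn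
          rw [cosCDF_neg_one, cosCDF_one hn] at h
          obtain ⟨c, hc, hc2⟩ := h (show (1 / 2 : ℝ) ∈ Icc (0 : ℝ) 1 by norm_num)
          refine ⟨c, hc, ?_⟩
          rw [hc2]
          norm_num [hk]

theorem lowerBound_eq (hn : 3 ≤ n) {m L : ℕ} (hm : 1 ≤ m) (hL : 1 ≤ L) :
    lowerBound (L * n) n m L =
      √L * meanBlockNorm n L * (1 - ∫ y in (-1 : ℝ)..1, cosCDF n y ^ m) := by
  rw [← natCast_mul_integral_mul_cosCDF_pow hn hm, lowerBound, meanBlockNorm]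
  have hL' : (L : ℝ) ≠ 0 := by exact_mod_cast (by omega : L ≠ 0)
  have h1 : (((L * n : ℕ) : ℝ) + L) / (2 * L) = ((n : ℝ) + 1) / 2 := by
    push_cast
    field_simp
  have h2 : ((L * n : ℕ) : ℝ) / (2 * L) = (n : ℝ) / 2 := by
    push_cast
    field_simp
  rw [h1, h2]
  ring

theorem JRan_eq_lowerBound (hn : 3 ≤ n) {m L : ℕ} (hm : 1 ≤ m) (hL : 1 ≤ L) :
    JRan n m L = lowerBound (L * n) n m L := by
  have : Nonempty (Fin m) := ⟨⟨0, hm⟩⟩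
  rw [lowerBound_eq hn hm hL]
  exact integral_J_multiLevel hn hL (W := fun ω => ω) (fun i => continuous_apply i)
    (integral_maxInner_uniform hn)

theorem lowerBound_lt_JSym (hn : 3 ≤ n) {k L : ℕ} (hk : k ≠ 0) (hL : 1 ≤ L) :
    lowerBound (L * n) n (k + k) L < JSym n (k + k) L := by
  rw [lowerBound_eq hn (by omega) hL, JSym, show (k + k) / 2 = k by omega]
  have : Nonempty (Fin k) := ⟨⟨0, by omega⟩⟩
  rw [integral_J_multiLevel hn hL continuous_antipodal (integral_maxInner_antipodal hn)]
  have hs : 0 < √(L : ℝ) := Real.sqrt_pos.2 (by exact_mod_cast hL)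
  exact mul_lt_mul_of_pos_left (sub_lt_sub_left (integral_absCosCDF_pow_lt hn hk) _)
    (mul_pos hs (meanBlockNorm_pos hn hL))

end Maximum

end

end RefAngle

theorem lemma3p5 (d L d' m : ℕ) (hL : 1 ≤ L) (hd : d = L * d') (hd' : 3 ≤ d') (hm : 1 ≤ m) :
    (Even m → RefAngle.JSym d' m L > RefAngle.lowerBound d d' m L) ∧
    RefAngle.JRan d' m L = RefAngle.lowerBound d d' m L ∧
    ∀ x : RefAngle.USphere (Fin d'),
      (RefAngle.sphereUniform (Fin d')).map
          (fun u : RefAngle.USphere (Fin d') => inner ℝ (x : EuclideanSpace ℝ (Fin d')) (u : EuclideanSpace ℝ (Fin d'))) =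
        (MeasureTheory.volume.restrict (Set.Icc (-1 : ℝ) 1)).withDensity
          (fun y => ENNReal.ofReal (RefAngle.cosDensity d' y)) ∧
      ∀ y ∈ Set.Icc (-1 : ℝ) 1,
        (RefAngle.sphereUniform (Fin d')).real
          {u : RefAngle.USphere (Fin d') | inner ℝ (x : EuclideanSpace ℝ (Fin d')) (u : EuclideanSpace ℝ (Fin d')) ≤ y} =
        RefAngle.cosCDF d' y := by
  subst hd
  refine ⟨?_, RefAngle.JRan_eq_lowerBound hd' hm hL, fun x =>
    ⟨RefAngle.map_inner_sphereUniform hd' x, fun y hy =>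
      RefAngle.sphereUniform_real_inner_le hd' x hy⟩⟩
  rintro ⟨k, rfl⟩
  exact RefAngle.lowerBound_lt_JSym hd' (by omega) hL
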